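/- Let $F=\mathbb F_q$ be a finite field with $q\ge 4$ elements, put $n=q^2-1$, and let $1\le i\le q-3$. Then there exists an $(n,\,n-2q+1,\,2i+1;\,1,\,d_{free}\ge q+i+3)_q$ convolutional code. Here an $(n,k,\gamma;\mu,d_{free}\ge d)_q$ convolutional code is a submodule $V$ of $F[D]^n$ of the form $V=\{u(D)G(D):u(D)\in F[D]^k\}$, where: * $G(D)=(g_{rj})\in F[D]^{k\times n}$ is basic (it has a polynomial right inverse) and reduced (with $\gamma_r=\max_j\deg g_{rj}$, the sum $\sum_r\gamma_r$ is smallest among all basic generator matrices of $V$); * $\sum_r\gamma_r=\gamma$ is the degree and $\max_r\gamma_r=\mu$ is the memory; * every nonzero $v(D)\in V$ has at least $d$ nonzero coefficients in total (and $V\neq 0$). Moreover, let $\alpha$ be any primitive element of $\mathbb F_{q^2}$ and let $M^{(s)}(x)$ be the minimal polynomial of $\alpha^s$ over $F$. Let $C_0$ and $C_1$ be the cyclic codes of length $n$ over $F$ with generator polynomials $M^{(0)}(x)M^{(1)}(x)\cdots M^{(q-1)}(x)$ and $M^{(q+1)}(x)M^{(q+2)}(x)\cdots M^{(q+1+i)}(x)$.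 Then $C_0$ and $C_1$ have parity check matrices $H_0\in F^{(2q-1)\times n}$ and $H_1\in F^{(2i+1)\times n}$, each with linearly independent rows, such that such a code $V$ is given by the Euclidean dual of the code $\{w(D)(H_0+\tilde H_1D):w(D)\in F[D]^{2q-1}\}$. Here $\tilde H_1$ is $H_1$ with zero rows added at the bottom so as to have $2q-1$ rows. The Euclidean dual of $W\subseteq F[D]^n$ is $\{u\in F[D]^n:\langle D^su\mid v\rangle=0\text{ for all }v\in W,\ s\ge 0\}$, where $\langle\sum_t u_tD^t\mid\sum_t v_tD^t\rangle=\sum_t u_t\cdot v_t$. -/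

import Mathlib

open Polynomial

namespace ConvCode

noncomputable section

/-! Convolutional codes over a field `F`; the indeterminate `D` is the polynomial variable `X`. -/

/-- A polynomial matrix is basic if it has a polynomial right inverse. -/
def IsBasic {F : Type*} [Field F] {k n : ℕ} (G : Matrix (Fin k) (Fin n) F[X]) : Prop :=
  ∃ R : Matrix (Fin n) (Fin k) F[X], G * R = 1

/-- The code `{u G : u ∈ F[D]^k}` generated by `G`. -/
def generatedCode {F : Type*} [Field F] {k n : ℕ} (G : Matrix (Fin k) (Fin n) F[X]) :
    Submodule F[X] (Fin n → F[X]) :=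
  LinearMap.range G.vecMulLinear

/-- The constraint length `γ_r = max_j deg g_{rj}` of the row `r`. -/
def rowDegree {F : Type*} [Field F] {k n : ℕ} (G : Matrix (Fin k) (Fin n) F[X])
    (r : Fin k) : ℕ :=
  Finset.univ.sup fun j => (G r j).natDegree

/-- The overall constraint length `∑_r γ_r`. -/
def overallConstraintLength {F : Type*} [Field F] {k n : ℕ}
    (G : Matrix (Fin k) (Fin n) F[X]) : ℕ :=
  ∑ r, rowDegree G r

/-- The memory `max_r γ_r`. -/
def memory {F : Type*} [Field F] {k n : ℕ} (G : Matrix (Fin k) (Fin n) F[X]) : ℕ :=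
  Finset.univ.sup fun r => rowDegree G r

/-- A basic matrix is reduced if its overall constraint length is the smallest among all basic
generator matrices of the same code. -/
def IsReducedBasic {F : Type*} [Field F] {k n : ℕ} (G : Matrix (Fin k) (Fin n) F[X]) : Prop :=
  IsBasic G ∧ ∀ G' : Matrix (Fin k) (Fin n) F[X], IsBasic G' →
    generatedCode G' = generatedCode G → overallConstraintLength G ≤ overallConstraintLength G'

/-- The weight of `v(D) = ∑_t v_t D^t`, the total number of nonzero coefficients of its entries. -/
def weight {F : Type*} [Field F] {n : ℕ} (v : Fin n → F[X]) : ℕ :=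
  ∑ j, (v j).support.card

/-- The free distance, the minimum weight of a nonzero codeword (`0` for the zero code). -/
def freeDistance {F : Type*} [Field F] {n : ℕ} (C : Submodule F[X] (Fin n → F[X])) : ℕ :=
  sInf {w | ∃ v ∈ C, v ≠ 0 ∧ weight v = w}

/-- `C` is an `(n, k, γ; μ, d_free ≥ d)` convolutional code over `F`. -/
def HasParameters {F : Type*} [Field F] {n : ℕ} (C : Submodule F[X] (Fin n → F[X]))
    (k γ μ d : ℕ) : Prop :=
  (∃ G : Matrix (Fin k) (Fin n) F[X], IsReducedBasic G ∧ C = generatedCode G ∧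
    overallConstraintLength G = γ ∧ memory G = μ) ∧ d ≤ freeDistance C

/-- The Euclidean inner product `∑_t u_t · v_t` of `u = ∑ u_t D^t` and `v = ∑ v_t D^t`. -/
def euclideanInner {F : Type*} [Field F] {n : ℕ} (u v : Fin n → F[X]) : F :=
  ∑ j, (u j).sum fun t a => a * (v j).coeff t

theorem euclideanInner_add_left {F : Type*} [Field F] {n : ℕ} (u u' v : Fin n → F[X]) :
    euclideanInner (u + u') v = euclideanInner u v + euclideanInner u' v := by
  unfold euclideanInner
  rw [← Finset.sum_add_distrib]
  refine Finset.sum_congr rfl fun j _ => ?_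
  rw [Pi.add_apply]
  exact Polynomial.sum_add_index _ _ _ (by simp) (by intros; ring)

/-- The Euclidean dual code of `C`: the vectors all of whose polynomial multiples (equivalently,
all of whose delays `D^s u`) are orthogonal to `C`. -/
def euclideanDual {F : Type*} [Field F] {n : ℕ} (C : Submodule F[X] (Fin n → F[X])) :
    Submodule F[X] (Fin n → F[X]) where
  carrier := {u | ∀ p : F[X], ∀ v ∈ C, euclideanInner (p • u) v = 0}
  add_mem' := by
    intro a b ha hb p v hv
    rw [smul_add, euclideanInner_add_left, ha p v hv, hb p v hv, add_zero]
  zero_mem' := by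
    intro p v _
    simp [euclideanInner]
  smul_mem' := by
    intro c u hu p v hv
    rw [smul_smul]
    exact hu (p * c) v hv

/-- The cyclic code of length `n` with generator polynomial `g` (a divisor of `X ^ n - 1`). -/
def cyclicCode {F : Type*} [Field F] (n : ℕ) (g : F[X]) : Submodule F (Fin n → F) where
  carrier := {v | g ∣ ∑ j, C (v j) * X ^ (j : ℕ)}
  add_mem' := by
    intro a b ha hb
    simp only [Set.mem_setOf_eq, Pi.add_apply, C_add, add_mul, Finset.sum_add_distrib] at *
    exact dvd_add ha hb
  zero_mem' := by simp
  smul_mem' := by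
    intro c v hv
    simp only [Set.mem_setOf_eq, Pi.smul_apply, smul_eq_mul, C_mul, mul_assoc,
      ← Finset.mul_sum] at *
    exact Dvd.dvd.mul_left hv _

/-- `H` is a parity check matrix, with linearly independent rows, of the block code `B`. -/
def IsParityCheckMatrix {F : Type*} [Field F] {r n : ℕ} (H : Matrix (Fin r) (Fin n) F)
    (B : Submodule F (Fin n → F)) : Prop :=
  LinearIndependent F H.row ∧ ∀ v, v ∈ B ↔ H.mulVec v = 0

/-- `H` with zero rows added at the bottom so as to have `κ` rows (for `r ≤ κ`). -/
def padRows {F : Type*} [Field F] {r n : ℕ} (κ : ℕ) (H : Matrix (Fin r) (Fin n) F) :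
    Matrix (Fin κ) (Fin n) F :=
  Matrix.of fun s j => if h : (s : ℕ) < r then H ⟨s, h⟩ j else 0

/-- The polynomial matrix `H₀ + H̃₁ D`, where `H̃₁` is `H₁` padded to the size of `H₀`. -/
def unitMemoryMatrix {F : Type*} [Field F] {κ r n : ℕ} (H₀ : Matrix (Fin κ) (Fin n) F)
    (H₁ : Matrix (Fin r) (Fin n) F) : Matrix (Fin κ) (Fin n) F[X] :=
  Matrix.of fun s j => C (H₀ s j) + C (padRows κ H₁ s j) * X

end

end ConvCode

namespace ConvCode

/-! ### The dual of a unit memory code -/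

section Dual

variable {F : Type*} [Field F] {n : ℕ}

/-! Write `u = ∑ u_t D^t`. Being dual to `H₀ + H̃₁ D`, with all delays allowed, means `H₀ u_t + H̃₁
u_{t+1} = 0` for all `t ≥ -1`, where `u_{-1} = 0`. So the lowest nonzero coefficient vector of `u`
lies in `ker H₁ = C₁` and the highest in `ker H₀ = C₀`. Either these are two different vectors and
the weight is at least `d(C₀) + d(C₁)`, or a single vector lies in `C₀ ∩ C₁`
(`le_weight_of_mem_euclideanDual`). Since `α^q` is conjugate to `α`, the code `C₀` has zeros `α^0,
…, α^q`; `C₁` has `α^(q+1), …, α^(q+1+i)`, and the two runs are adjacent. `bch_bound` gives `q + 2`,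
`i + 2`, and `q + i + 3` for the intersection.

The degree and memory come from `hasParameters_euclideanDual`. The generators of `C₀` and `C₁` are
coprime, so `H₀` and `H₁` stacked are surjective and extend to an invertible matrix. The columns of
its inverse give `r` generators of degree 1 and `m` constant ones. No basic generator matrix has
smaller degree, because its constant rows are independent words of the `m`-dimensional space `C₀ ∩
C₁`. -/

theorem euclideanInner_add_right (u v v' : Fin n → F[X]) :
    euclideanInner u (v + v') = euclideanInner u v + euclideanInner u v' := by
  simp [euclideanInner, Polynomial.sum, mul_add, Finset.sum_add_distrib]

theorem euclideanInner_zero_right (u : Fin n → F[X]) : euclideanInner u 0 = 0 := by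
  simp [euclideanInner, Polynomial.sum]

theorem euclideanInner_sum_right {ι : Type*} (s : Finset ι) (u : Fin n → F[X])
    (v : ι → Fin n → F[X]) :
    euclideanInner u (∑ l ∈ s, v l) = ∑ l ∈ s, euclideanInner u (v l) := by
  classical
  induction s using Finset.induction_on with
  | empty => simp [euclideanInner_zero_right]
  | insert a s ha ih => rw [Finset.sum_insert ha, Finset.sum_insert ha, euclideanInner_add_right, ih]

theorem euclideanInner_monomial_right (u : Fin n → F[X]) (c : Fin n → F) (t : ℕ) :
    euclideanInner u (fun j => monomial t (c j)) = ∑ j, c j * (u j).coeff t := by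
  refine Finset.sum_congr rfl fun j _ => ?_
  rw [Polynomial.sum, Finset.sum_eq_single t]
  · rw [coeff_monomial, if_pos rfl, mul_comm]
  · intro b _ hb
    rw [coeff_monomial, if_neg hb.symm, mul_zero]
  · intro h
    rw [notMem_support_iff.1 h, zero_mul]

/-- The polynomial whose coefficients are the inner products of the delays of `u` with the delays
of `h₀ + h₁ D`. -/
noncomputable def correlation (h₀ h₁ : Fin n → F) (u : Fin n → F[X]) : F[X] :=
  X * ∑ j, C (h₀ j) * u j + ∑ j, C (h₁ j) * u j

theorem correlation_smul (h₀ h₁ : Fin n → F) (p : F[X]) (u : Fin n → F[X]) :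
    correlation h₀ h₁ (p • u) = p * correlation h₀ h₁ u := by
  simp only [correlation, Pi.smul_apply, smul_eq_mul, mul_add, Finset.mul_sum]
  congr 1 <;> exact Finset.sum_congr rfl fun j _ => by ring

theorem euclideanInner_monomial_smul (u : Fin n → F[X]) (h₀ h₁ : Fin n → F) (t : ℕ) (a : F) :
    euclideanInner u (monomial t a • fun j => C (h₀ j) + C (h₁ j) * X) =
      a * (correlation h₀ h₁ u).coeff (t + 1) := by
  have h : (monomial t a • fun j => C (h₀ j) + C (h₁ j) * X) =
      (fun j => monomial t (a * h₀ j)) + fun j => monomial (t + 1) (a * h₁ j) := by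
    funext j
    simp only [Pi.smul_apply, smul_eq_mul, Pi.add_apply, mul_add]
    rw [monomial_mul_C, ← mul_assoc, monomial_mul_C, monomial_mul_X]
  rw [h, euclideanInner_add_right, euclideanInner_monomial_right, euclideanInner_monomial_right,
    correlation, coeff_add, coeff_X_mul, finsetSum_coeff, finsetSum_coeff, mul_add,
    Finset.mul_sum, Finset.mul_sum]
  simp only [coeff_C_mul, mul_assoc]

/-- Coefficient `t + 1` of the correlation pairs `u` with `D^t` times a row. Coefficient `0`, the
condition on `u_0` alone, is seen only after delaying `u`. -/
theorem mem_euclideanDual_unitMemoryMatrix_iff {κ r : ℕ} (H₀ : Matrix (Fin κ) (Fin n) F)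
    (H₁ : Matrix (Fin r) (Fin n) F) (u : Fin n → F[X]) :
    u ∈ euclideanDual (generatedCode (unitMemoryMatrix H₀ H₁)) ↔
      ∀ s, correlation (H₀ s) (padRows κ H₁ s) u = 0 := by
  constructor
  · intro hu s
    ext t
    have hmem : (monomial t (1 : F) • fun j => C (H₀ s j) + C (padRows κ H₁ s j) * X) ∈
        generatedCode (unitMemoryMatrix H₀ H₁) := by
      refine Submodule.smul_mem _ _ ⟨Pi.single s 1, ?_⟩
      rw [Matrix.vecMulLinear_apply, Matrix.single_one_vecMul]
      rfl
    -- Multiplying `u` by `X` shifts the correlation by one, so that its constant coefficient is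
    -- reached too.
    have := hu X _ hmem
    rwa [euclideanInner_monomial_smul, one_mul, correlation_smul, coeff_X_mul] at this
  · rintro hu p _ ⟨w, rfl⟩
    have hw : (unitMemoryMatrix H₀ H₁).vecMulLinear w =
        ∑ s, ∑ t ∈ (w s).support, (monomial t ((w s).coeff t) • fun j =>
          C (H₀ s j) + C (padRows κ H₁ s j) * X) := by
      rw [Matrix.vecMulLinear_apply, Matrix.vecMul_eq_sum]
      refine Finset.sum_congr rfl fun s _ => ?_
      rw [← Finset.sum_smul, ← (w s).as_sum_support]
      rfl
    rw [hw, euclideanInner_sum_right]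
    refine Finset.sum_eq_zero fun s _ => ?_
    rw [euclideanInner_sum_right]
    refine Finset.sum_eq_zero fun t _ => ?_
    rw [euclideanInner_monomial_smul, correlation_smul, hu s, mul_zero, coeff_zero, mul_zero]

/-- Membership in the dual of `H₀ + H̃₁ D` in terms of the coefficient vectors. -/
theorem mulVec_coeff_of_mem_euclideanDual {κ r : ℕ} (hrκ : r ≤ κ) {H₀ : Matrix (Fin κ) (Fin n) F}
    {H₁ : Matrix (Fin r) (Fin n) F} {u : Fin n → F[X]}
    (hu : u ∈ euclideanDual (generatedCode (unitMemoryMatrix H₀ H₁))) (t : ℕ) :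
    ((∀ j, (u j).coeff (t + 1) = 0) → H₀.mulVec (fun j => (u j).coeff t) = 0) ∧
    ((∀ j, t ≠ 0 → (u j).coeff (t - 1) = 0) → H₁.mulVec (fun j => (u j).coeff t) = 0) := by
  rw [mem_euclideanDual_unitMemoryMatrix_iff] at hu
  constructor
  · intro h
    funext s
    have := congrArg (fun p => coeff p (t + 1)) (hu s)
    simpa [correlation, finsetSum_coeff, h, Matrix.mulVec, dotProduct] using this
  · intro h
    funext s
    have := congrArg (fun p => coeff p t) (hu (Fin.castLE hrκ s))
    have h0 : (X * ∑ j, C (H₀ (Fin.castLE hrκ s) j) * u j).coeff t = 0 := by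
      cases t with
      | zero => simp
      | succ t => simpa [finsetSum_coeff] using
          Finset.sum_eq_zero fun j _ => by rw [show (u j).coeff t = 0 from h j (by simp), mul_zero]
    simpa [correlation, h0, finsetSum_coeff, padRows, Matrix.mulVec, dotProduct] using this

/-- A word of the dual of `H₀ + H̃₁ D` has coefficient vectors in `ker H₁` (the first one) and in
`ker H₀` (the last one); these may coincide. -/
theorem le_weight_of_mem_euclideanDual {κ r : ℕ} (hrκ : r ≤ κ) {H₀ : Matrix (Fin κ) (Fin n) F}
    {H₁ : Matrix (Fin r) (Fin n) F} {d d₀ d₁ : ℕ}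
    (hd₀ : ∀ v, v ≠ 0 → H₀.mulVec v = 0 → d₀ ≤ {j | v j ≠ 0}.ncard)
    (hd₁ : ∀ v, v ≠ 0 → H₁.mulVec v = 0 → d₁ ≤ {j | v j ≠ 0}.ncard)
    (hd : ∀ v, v ≠ 0 → H₀.mulVec v = 0 → H₁.mulVec v = 0 → d ≤ {j | v j ≠ 0}.ncard)
    (hsum : d ≤ d₀ + d₁) {u : Fin n → F[X]}
    (hu : u ∈ euclideanDual (generatedCode (unitMemoryMatrix H₀ H₁))) (hu0 : u ≠ 0) :
    d ≤ weight u := by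
  classical
  have hcard : ∀ v : Fin n → F, {j | v j ≠ 0}.ncard = ∑ j, if v j ≠ 0 then 1 else 0 := by
    intro v
    rw [← Finset.card_filter, ← Set.ncard_coe_finset]
    simp
  obtain ⟨j₀, hj₀⟩ := Function.ne_iff.1 hu0
  have hex : ∃ t, ∃ j, (u j).coeff t ≠ 0 := ⟨_, j₀, leadingCoeff_ne_zero.2 hj₀⟩
  set a := Nat.find hex with ha
  have hmin : ∀ t < a, ∀ j, (u j).coeff t = 0 := fun t ht j => by
    by_contra h
    exact Nat.find_min hex ht ⟨j, h⟩
  have hane : (fun j => (u j).coeff a) ≠ 0 := Function.ne_iff.2 (Nat.find_spec hex)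
  set b := Finset.univ.sup fun j => (u j).natDegree with hb
  have hmax : ∀ t, b < t → ∀ j, (u j).coeff t = 0 := fun t ht j =>
    coeff_eq_zero_of_natDegree_lt ((Finset.le_sup (f := fun j => (u j).natDegree)
      (Finset.mem_univ j)).trans_lt ht)
  have hbne : (fun j => (u j).coeff b) ≠ 0 := by
    -- The supremum `0` could come from a zero entry, so here the nonvanishing is taken from the
    -- index `a`.
    by_cases hb0 : b = 0
    · have : a ≤ b := by
        by_contra h
        exact hane (funext (hmax a (not_le.1 h)))
      have hab : a = b := by omega
      rwa [← hab]
    · obtain ⟨j, -, hj⟩ := Finset.exists_mem_eq_sup Finset.univ ⟨j₀, Finset.mem_univ _⟩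
        (fun j => (u j).natDegree)
      refine Function.ne_iff.2 ⟨j, ?_⟩
      have hj' : b = (u j).natDegree := hj
      have : u j ≠ 0 := fun h => hb0 (by rw [hj', h, natDegree_zero])
      simpa [hj'] using this
  have h₀ := (mulVec_coeff_of_mem_euclideanDual hrκ hu b).1 (hmax _ (Nat.lt_succ_self b))
  have h₁ := (mulVec_coeff_of_mem_euclideanDual hrκ hu a).2
    (fun j h => hmin _ (by omega) j)
  by_cases hab : a = b
  · refine (hd _ hane (hab ▸ h₀) h₁).trans ?_
    rw [hcard]
    refine Finset.sum_le_sum fun j _ => ?_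
    split_ifs with h
    · exact Finset.card_pos.2 ⟨a, mem_support_iff.2 h⟩
    · exact Nat.zero_le _
  · refine (hsum.trans (add_le_add (hd₀ _ hbne h₀) (hd₁ _ hane h₁))).trans ?_
    rw [hcard, hcard, ← Finset.sum_add_distrib]
    refine Finset.sum_le_sum fun j _ => ?_
    have hsub : ({b, a} : Finset ℕ).filter (fun t => (u j).coeff t ≠ 0) ⊆ (u j).support :=
      fun t ht => mem_support_iff.2 (Finset.mem_filter.1 ht).2
    refine le_trans (le_of_eq ?_) (Finset.card_le_card hsub)
    rw [Finset.card_filter, Finset.sum_pair (Ne.symm hab)]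

end Dual

/-! ### A reduced basic generator matrix of the dual -/

section Generator

variable {F : Type*} [Field F] {n : ℕ}

/-- A jointly surjective pair of matrices is part of an invertible matrix. -/
theorem exists_complement {κ r m : ℕ} (hn : n = κ + r + m) (H₀ : Matrix (Fin κ) (Fin n) F)
    (H₁ : Matrix (Fin r) (Fin n) F)
    (hsurj : ∀ a b, ∃ v, H₀.mulVec v = a ∧ H₁.mulVec v = b) :
    ∃ (B : Matrix (Fin n) (Fin κ) F) (E : Matrix (Fin n) (Fin r) F)
      (Z : Matrix (Fin n) (Fin m) F) (N : Matrix (Fin m) (Fin n) F),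
      H₀ * B = 1 ∧ H₀ * E = 0 ∧ H₀ * Z = 0 ∧ H₁ * B = 0 ∧ H₁ * E = 1 ∧ H₁ * Z = 0 ∧
      N * B = 0 ∧ N * E = 0 ∧ N * Z = 1 ∧ B * H₀ + E * H₁ + Z * N = 1 := by
  set L := H₀.mulVecLin.prod H₁.mulVecLin with hL
  have hLs : Function.Surjective L := by
    rintro ⟨a, b⟩
    obtain ⟨v, h0, h1⟩ := hsurj a b
    exact ⟨v, Prod.ext h0 h1⟩
  have hker : Module.finrank F (LinearMap.ker L) = m := by
    have := L.finrank_range_add_finrank_ker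
    rw [LinearMap.range_eq_top.2 hLs, finrank_top, Module.finrank_prod] at this
    simp only [Module.finrank_fintype_fun_eq_card, Fintype.card_fin] at this
    omega
  -- A section `T` of `L` splits the space as `im T ⊕ ker L`: `B` and `E` are the two halves of `T`,
  -- `Z` is a basis of `ker L`, and `N` gives coordinates after the projection `P = id - T L`.
  obtain ⟨T, hT⟩ := L.exists_rightInverse_of_surjective (LinearMap.range_eq_top.2 hLs)
  have hT' : ∀ x, L (T x) = x := fun x => LinearMap.congr_fun hT x
  let z := (Module.finBasisOfFinrankEq F _ hker).equivFun
  let P : (Fin n → F) →ₗ[F] LinearMap.ker L :=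
    (LinearMap.id - T ∘ₗ L).codRestrict _ fun v => by simp [hT']
  have hP : ∀ v, (P v : Fin n → F) = v - T (L v) := fun v => rfl
  have hPT : ∀ x, P (T x) = 0 := fun x => Subtype.ext (by simp [hP, hT'])
  have hPk : ∀ x : LinearMap.ker L, P x = x := fun x => Subtype.ext (by
    rw [hP, LinearMap.mem_ker.1 x.2, map_zero, sub_zero])
  let B := LinearMap.toMatrix' (T ∘ₗ LinearMap.inl F _ _)
  let E := LinearMap.toMatrix' (T ∘ₗ LinearMap.inr F (Fin κ → F) _)
  let Z := LinearMap.toMatrix' ((LinearMap.ker L).subtype ∘ₗ z.symm.toLinearMap)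
  let N := LinearMap.toMatrix' (z.toLinearMap ∘ₗ P)
  have h0 : ∀ v, H₀.mulVec v = (L v).1 := fun v => rfl
  have h1 : ∀ v, H₁.mulVec v = (L v).2 := fun v => rfl
  have hB : ∀ v, B.mulVec v = T (v, 0) := fun v => by simp [B, ← Matrix.toLin'_apply]
  have hE : ∀ v, E.mulVec v = T (0, v) := fun v => by simp [E, ← Matrix.toLin'_apply]
  have hZ : ∀ v, Z.mulVec v = z.symm v := fun v => by simp [Z, ← Matrix.toLin'_apply]
  have hN : ∀ v, N.mulVec v = z (P v) := fun v => by simp [N, ← Matrix.toLin'_apply]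
  have hLz : ∀ v, L (z.symm v : LinearMap.ker L) = 0 := fun v => (z.symm v).2
  refine ⟨B, E, Z, N, ?_, ?_, ?_, ?_, ?_, ?_, ?_, ?_, ?_, ?_⟩ <;>
    refine Matrix.ext_of_mulVec_single fun l => ?_ <;>
    simp only [Matrix.add_mulVec, ← Matrix.mulVec_mulVec, h0, h1, hB, hE, hZ, hN, hT', hLz, hPT,
      hPk, Matrix.one_mulVec, Matrix.zero_mulVec, map_zero, Prod.fst_zero, Prod.snd_zero,
      LinearEquiv.apply_symm_apply, LinearEquiv.symm_apply_apply, ← map_add, Prod.mk_add_mk,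
      zero_add, add_zero, Prod.mk.eta, hP, add_sub_cancel]

end Generator

/-! ### Degree, memory and free distance of the dual -/

section Parameters

variable {F : Type*} [Field F] {n : ℕ}

/-- The word with constant entries `v`. -/
noncomputable def constWord (v : Fin n → F) : Fin n → F[X] := fun j => C (v j)

theorem correlation_constWord (h₀ h₁ v : Fin n → F) :
    correlation h₀ h₁ (constWord v) = X * C (h₀ ⬝ᵥ v) + C (h₁ ⬝ᵥ v) := by
  simp [correlation, constWord, dotProduct]

theorem correlation_sub (h₀ h₁ : Fin n → F) (u v : Fin n → F[X]) :
    correlation h₀ h₁ (u - v) = correlation h₀ h₁ u - correlation h₀ h₁ v := by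
  simp only [correlation, Pi.sub_apply, mul_sub, Finset.sum_sub_distrib]
  ring

theorem padRows_eq_zero {κ r : ℕ} (H : Matrix (Fin r) (Fin n) F) {s : Fin κ} (hs : ¬ (s : ℕ) < r) :
    padRows κ H s = 0 := funext fun j => by simp [padRows, hs]

theorem padRows_castLE {κ r : ℕ} (hrκ : r ≤ κ) (H : Matrix (Fin r) (Fin n) F) (s : Fin r) :
    padRows κ H (Fin.castLE hrκ s) = H s := funext fun j => by simp [padRows]

theorem constWord_mem_euclideanDual_iff {κ r : ℕ} (hrκ : r ≤ κ) (H₀ : Matrix (Fin κ) (Fin n) F)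
    (H₁ : Matrix (Fin r) (Fin n) F) (v : Fin n → F) :
    constWord v ∈ euclideanDual (generatedCode (unitMemoryMatrix H₀ H₁)) ↔
      H₀.mulVec v = 0 ∧ H₁.mulVec v = 0 := by
  rw [mem_euclideanDual_unitMemoryMatrix_iff]
  simp only [correlation_constWord]
  constructor
  · intro h
    constructor <;> funext s
    · have := congrArg (fun p => coeff p 1) (h s)
      simpa [coeff_C, Matrix.mulVec] using this
    · have := congrArg (fun p => coeff p 0) (h (Fin.castLE hrκ s))
      simpa [padRows_castLE, Matrix.mulVec] using this
  · rintro ⟨h0, h1⟩ s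
    rw [show H₀ s ⬝ᵥ v = 0 from congrFun h0 s]
    by_cases hs : (s : ℕ) < r
    · rw [show s = Fin.castLE hrκ ⟨s, hs⟩ from rfl, padRows_castLE,
        show H₁ ⟨s, hs⟩ ⬝ᵥ v = 0 from congrFun h1 _]
      simp
    · simp [padRows_eq_zero H₁ hs]

/-- A basic generator matrix has at most as many constant rows as the constant words of the code
have dimension. -/
theorem card_constant_rows_le {k m : ℕ} {G : Matrix (Fin k) (Fin n) F[X]} (hG : IsBasic G)
    (S : Submodule F (Fin n → F)) (hS : ∀ v, constWord v ∈ generatedCode G → v ∈ S)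
    (hm : Module.finrank F S = m) :
    (Finset.univ.filter fun s => rowDegree G s = 0).card ≤ m := by
  classical
  obtain ⟨R, hR⟩ := hG
  have hrow : ∀ s : {s // rowDegree G s = 0}, G s = constWord fun j => (G s j).coeff 0 := by
    rintro ⟨s, hs⟩
    funext j
    have : (G s j).natDegree ≤ rowDegree G s :=
      Finset.le_sup (f := fun j => (G s j).natDegree) (Finset.mem_univ j)
    exact eq_C_of_natDegree_eq_zero (Nat.le_zero.1 (this.trans hs.le))
  have hmem : ∀ s : {s // rowDegree G s = 0}, (fun j => (G s j).coeff 0) ∈ S := fun s => by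
    refine hS _ ⟨Pi.single s 1, ?_⟩
    rw [Matrix.vecMulLinear_apply, Matrix.single_one_vecMul, ← hrow]
    rfl
  have hli : LinearIndependent F
      (fun s : {s // rowDegree G s = 0} => (⟨_, hmem s⟩ : S)) := by
    rw [Fintype.linearIndependent_iff]
    intro g hg s
    have hg' : ∑ s, C (g s) • G s = 0 := by
      funext j
      have := congrArg (fun v : S => (v : Fin n → F) j) hg
      simp only [Submodule.coe_sum, Submodule.coe_smul, Finset.sum_apply, Pi.smul_apply,
        smul_eq_mul, Submodule.coe_zero, Pi.zero_apply] at this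
      rw [Finset.sum_apply, Pi.zero_apply, ← C_0, ← this, map_sum]
      refine Finset.sum_congr rfl fun s _ => ?_
      rw [Pi.smul_apply, smul_eq_mul, C_mul]
      exact congrArg _ (congrFun (hrow s) j)
    -- The right inverse carries a relation among rows of `G` to one among rows of the identity.
    have hz : ∑ s : {s // rowDegree G s = 0}, C (g s) • (G * R) s = 0 := by
      have : ∀ s, (G * R) s = Matrix.vecMul (G s) R := fun s => rfl
      simp only [this, ← Matrix.smul_vecMul]
      rw [← Matrix.sum_vecMul, hg', Matrix.zero_vecMul]
    have := congrFun hz s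
    rw [hR, Finset.sum_apply, Finset.sum_eq_single s] at this
    · simpa using this
    · intro b _ hb
      simp [Matrix.one_apply_ne (Subtype.coe_injective.ne hb)]
    · simp
  have := hli.fintype_card_le_finrank
  rwa [hm, Fintype.card_subtype] at this

/-- Each of the at least `k - m` nonconstant rows contributes at least 1. -/
theorem le_overallConstraintLength {k m : ℕ} {G : Matrix (Fin k) (Fin n) F[X]} (hG : IsBasic G)
    (S : Submodule F (Fin n → F)) (hS : ∀ v, constWord v ∈ generatedCode G → v ∈ S)
    (hm : Module.finrank F S = m) : k ≤ overallConstraintLength G + m := by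
  classical
  have h1 := card_constant_rows_le hG S hS hm
  have h2 : k = ∑ s : Fin k, 1 := by simp
  rw [Finset.card_filter] at h1
  refine le_trans ?_ (Nat.add_le_add_left h1 _)
  conv_lhs => rw [h2]
  rw [overallConstraintLength, ← Finset.sum_add_distrib]
  refine Finset.sum_le_sum fun s _ => ?_
  split_ifs with h <;> omega

theorem dotProduct_constWord (v w : Fin n → F) :
    constWord v ⬝ᵥ constWord w = C (v ⬝ᵥ w) := by
  simp [constWord, dotProduct]

theorem exists_matrix_append {R : Type*} {r m : ℕ} (f : Fin r → Fin n → R) (g : Fin m → Fin n → R) :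
    ∃ G : Matrix (Fin (r + m)) (Fin n) R,
      (∀ a, G (Fin.castAdd m a) = f a) ∧ ∀ l, G (Fin.natAdd r l) = g l :=
  ⟨Fin.append f g, fun a => by rw [Fin.append_left], fun l => by rw [Fin.append_right]⟩

/-- The dual of `H₀ + H̃₁ D`, for jointly surjective `H₀` and `H₁`, is a code of memory `1` whose
degree is the number of rows of `H₁`. -/
theorem hasParameters_euclideanDual {κ r k d : ℕ} (hrκ : r ≤ κ) (hr : 0 < r) (hn : κ + r ≤ n)
    (hk : κ + k = n) (H₀ : Matrix (Fin κ) (Fin n) F) (H₁ : Matrix (Fin r) (Fin n) F)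
    (hsurj : ∀ a b, ∃ v, H₀.mulVec v = a ∧ H₁.mulVec v = b)
    (hd : ∀ u ∈ euclideanDual (generatedCode (unitMemoryMatrix H₀ H₁)), u ≠ 0 → d ≤ weight u) :
    HasParameters (euclideanDual (generatedCode (unitMemoryMatrix H₀ H₁))) k r 1 d := by
  classical
  obtain ⟨m, rfl⟩ : ∃ m, k = r + m := ⟨k - r, by omega⟩
  obtain ⟨B, E, Z, N, hHB, hHE, hHZ, hIB, hIE, hIZ, hNB, hNE, hNZ, hone⟩ :=
    exists_complement (show n = κ + r + m by omega) H₀ H₁ hsurj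
  set V := euclideanDual (generatedCode (unitMemoryMatrix H₀ H₁)) with hV
  let ι : Fin r → Fin κ := Fin.castLE hrκ
  -- For `b - X e` the correlation with row `a` is `X · 1 - X · 1 = 0`: `H₀` sees only `b`, `H₁`
  -- only `e`. The columns of `Z` are killed by both.
  obtain ⟨G, hGl, hGr⟩ := exists_matrix_append
    (fun a => constWord (B.col (ι a)) - (X : F[X]) • constWord (E.col a))
    fun l => constWord (Z.col l)
  have hbasic : IsBasic G := by
    -- These rows are dual to the `b` and `z` columns and vanish on the `e` columns.
    obtain ⟨R', hRl, hRr⟩ := exists_matrix_append (fun a => constWord (H₀ (ι a)))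
      fun l => constWord (N l)
    have e1 : ∀ a b, H₀ a ⬝ᵥ B.col b = (1 : Matrix _ _ F) a b := fun a b => by rw [← hHB]; rfl
    have e2 : ∀ a b, H₀ a ⬝ᵥ E.col b = 0 := fun a b => congrFun (congrFun hHE a) b
    have e3 : ∀ a b, H₀ a ⬝ᵥ Z.col b = 0 := fun a b => congrFun (congrFun hHZ a) b
    have e4 : ∀ a b, N a ⬝ᵥ B.col b = 0 := fun a b => congrFun (congrFun hNB a) b
    have e5 : ∀ a b, N a ⬝ᵥ E.col b = 0 := fun a b => congrFun (congrFun hNE a) b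
    have e6 : ∀ a b, N a ⬝ᵥ Z.col b = (1 : Matrix _ _ F) a b := fun a b => by rw [← hNZ]; rfl
    have hι : Function.Injective ι := Fin.castLE_injective hrκ
    refine ⟨R'.transpose, ?_⟩
    ext1 s t
    change G s ⬝ᵥ R' t = _
    induction s using Fin.addCases <;> induction t using Fin.addCases <;>
      simp only [hGl, hGr, hRl, hRr, sub_dotProduct, smul_dotProduct, dotProduct_constWord,
        dotProduct_comm (B.col _), dotProduct_comm (E.col _), dotProduct_comm (Z.col _),
        e1, e2, e3, e4, e5, e6, C_0, smul_zero, sub_zero] <;>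
      simp [Matrix.one_apply, Fin.ext_iff, ι, eq_comm, apply_ite C]
    all_goals omega
  have hGV : ∀ s, G s ∈ V := by
    intro s
    induction s using Fin.addCases with
    | left a =>
      rw [hGl, hV, mem_euclideanDual_unitMemoryMatrix_iff]
      intro s
      have e1 : H₀ s ⬝ᵥ B.col (ι a) = (1 : Matrix _ _ F) s (ι a) := by rw [← hHB]; rfl
      have e2 : H₀ s ⬝ᵥ E.col a = 0 := congrFun (congrFun hHE s) a
      rw [correlation_sub, correlation_smul, correlation_constWord, correlation_constWord, e1, e2]
      by_cases hs : (s : ℕ) < r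
      · obtain ⟨s, rfl⟩ : ∃ s', s = ι s' := ⟨⟨s, hs⟩, rfl⟩
        have e3 : H₁ s ⬝ᵥ B.col (ι a) = 0 := congrFun (congrFun hIB s) _
        have e4 : H₁ s ⬝ᵥ E.col a = (1 : Matrix _ _ F) s a := by rw [← hIE]; rfl
        rw [padRows_castLE, e3, e4]
        simp [Matrix.one_apply, ι]
      · rw [padRows_eq_zero H₁ hs, Matrix.one_apply_ne]
        · simp
        · rintro rfl
          exact hs a.2
    | right l =>
      rw [hGr, hV, constWord_mem_euclideanDual_iff hrκ]
      exact ⟨funext fun s => congrFun (congrFun hHZ s) l,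
        funext fun s => congrFun (congrFun hIZ s) l⟩
  have hgen : V = generatedCode G := by
    apply le_antisymm
    · intro u hu
      rw [hV, mem_euclideanDual_unitMemoryMatrix_iff] at hu
      -- Expand `u` through `B H₀ + E H₁ + Z N = 1`. Duality gives `H₁ u = -X H₀ u` on the first `r`
      -- rows and `H₀ u = 0` on the others, so `H₀ u` and `N u` are the coordinates of `u` with
      -- respect to `G`.
      have key : ∀ j, u j = ∑ s, C (B j s) * (∑ i, C (H₀ s i) * u i) +
          ∑ a, C (E j a) * (∑ i, C (H₁ a i) * u i) +
          ∑ l, C (Z j l) * (∑ i, C (N l i) * u i) := by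
        intro j
        have h1 : u j = ∑ i, C ((1 : Matrix (Fin n) (Fin n) F) j i) * u i := by
          simp [Matrix.one_apply, apply_ite C]
        rw [h1, ← hone]
        simp only [Matrix.add_apply, Matrix.mul_apply, C_add, map_sum, C_mul, add_mul,
          Finset.sum_add_distrib, Finset.sum_mul, Finset.mul_sum, mul_assoc]
        refine congrArg₂ _ (congrArg₂ _ ?_ ?_) ?_ <;> rw [Finset.sum_comm]
      have h1 : ∀ a, ∑ i, C (H₁ a i) * u i = -(X * ∑ i, C (H₀ (ι a) i) * u i) := fun a => by
        have := hu (ι a)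
        rw [padRows_castLE] at this
        exact eq_neg_of_add_eq_zero_right this
      have h0 : ∀ s : Fin κ, ¬ (s : ℕ) < r → ∑ i, C (H₀ s i) * u i = 0 := fun s hs => by
        have := hu s
        rw [padRows_eq_zero H₁ hs] at this
        simpa [correlation] using this
      have h0' : ∀ f : Fin κ → F[X], (∀ s : Fin κ, ¬ (s : ℕ) < r → f s = 0) →
          ∑ s, f s = ∑ a, f (ι a) := fun f hf => by
        refine (Fintype.sum_of_injective ι (Fin.castLE_injective hrκ) _ _ ?_ ?_).symm
        · intro s hs
          refine hf s fun h => hs ⟨⟨s, h⟩, rfl⟩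
        · intro _
          rfl
      refine ⟨Fin.addCases (motive := fun _ => F[X]) (fun a => ∑ i, C (H₀ (ι a) i) * u i)
        (fun l => ∑ i, C (N l i) * u i), ?_⟩
      funext j
      rw [Matrix.vecMulLinear_apply, Matrix.vecMul_eq_sum, Fin.sum_univ_add, key j, h0']
      · simp only [hGl, hGr, Fin.addCases_left, Fin.addCases_right, Pi.add_apply, Finset.sum_apply,
          Pi.smul_apply, Pi.sub_apply, constWord, h1, smul_eq_mul, Matrix.col_apply]
        rw [← Finset.sum_add_distrib]
        refine congrArg₂ _ (Finset.sum_congr rfl fun a _ => ?_)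
          (Finset.sum_congr rfl fun l _ => mul_comm _ _)
        ring
      · intro s hs
        rw [h0 s hs, mul_zero]
    · rintro _ ⟨w, rfl⟩
      rw [Matrix.vecMulLinear_apply, Matrix.vecMul_eq_sum]
      exact Submodule.sum_mem _ fun s _ => Submodule.smul_mem _ _ (hGV s)
  have hrow0 : ∀ l, rowDegree G (Fin.natAdd r l) = 0 := fun l =>
    Nat.le_zero.1 (Finset.sup_le fun j _ => by rw [hGr, constWord, natDegree_C])
  have hconst : ∀ v, constWord v ∈ V ↔ v ∈ LinearMap.ker (H₀.mulVecLin.prod H₁.mulVecLin) := by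
    intro v
    rw [hV, constWord_mem_euclideanDual_iff hrκ, LinearMap.mem_ker]
    exact Prod.mk_eq_zero.symm
  have hker : Module.finrank F (LinearMap.ker (H₀.mulVecLin.prod H₁.mulVecLin)) = m := by
    have h := (H₀.mulVecLin.prod H₁.mulVecLin).finrank_range_add_finrank_ker
    rw [LinearMap.range_eq_top.2, finrank_top, Module.finrank_prod] at h
    · simp only [Module.finrank_fintype_fun_eq_card, Fintype.card_fin] at h
      omega
    · rintro ⟨a, b⟩
      obtain ⟨v, h0, h1⟩ := hsurj a b
      exact ⟨v, Prod.ext h0 h1⟩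
  have hlb : ∀ G' : Matrix (Fin (r + m)) (Fin n) F[X], IsBasic G' → generatedCode G' = V →
      r ≤ overallConstraintLength G' := fun G' hG' hG'V => by
    have := le_overallConstraintLength hG' _ (fun v hv => (hconst v).1 (hG'V ▸ hv)) hker
    omega
  have hrow1 : ∀ a, rowDegree G (Fin.castAdd m a) ≤ 1 := fun a => Finset.sup_le fun j _ => by
    rw [hGl]
    simp only [Pi.sub_apply, Pi.smul_apply, constWord, smul_eq_mul]
    exact (natDegree_sub_le _ _).trans (max_le (by simp)
      ((natDegree_mul_C_le _ _).trans natDegree_X_le))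
  have hle : overallConstraintLength G ≤ r := by
    rw [overallConstraintLength, Fin.sum_univ_add]
    simp only [hrow0, Finset.sum_const_zero, add_zero]
    exact (Finset.sum_le_sum fun a _ => hrow1 a).trans (by simp)
  have heq : overallConstraintLength G = r := le_antisymm hle (hlb G hbasic hgen.symm)
  have hmem : memory G = 1 := by
    apply le_antisymm
    · refine Finset.sup_le fun s _ => ?_
      induction s using Fin.addCases with
      | left a => exact hrow1 a
      | right l => rw [hrow0]; exact zero_le_one
    · by_contra h
      have h0 : ∀ s, rowDegree G s = 0 := fun s => by
        have : rowDegree G s ≤ memory G := Finset.le_sup (Finset.mem_univ s)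
        omega
      rw [overallConstraintLength, Finset.sum_eq_zero fun s _ => h0 s] at heq
      omega
  refine ⟨⟨G, ⟨hbasic, fun G' h h' => heq.le.trans (hlb G' h (h'.trans hgen.symm))⟩, hgen, heq, hmem⟩,
    ?_⟩
  obtain ⟨R, hR⟩ := hbasic
  let s₀ : Fin (r + m) := Fin.castAdd m ⟨0, hr⟩
  -- `sInf` of the empty set is `0`, so a nonzero codeword is needed: a row of the basic matrix `G`.
  refine le_csInf ⟨_, G s₀, hGV s₀, fun h => ?_, rfl⟩ ?_
  · have h1 : (G * R) s₀ s₀ = G s₀ ⬝ᵥ fun j => R j s₀ := rfl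
    rw [hR, h, zero_dotProduct, Matrix.one_apply_eq] at h1
    exact one_ne_zero h1
  · rintro _ ⟨u, hu, hu0, rfl⟩
    exact hd u hu hu0

end Parameters

/-! ### Cyclic codes: parity check matrices and the BCH bound -/

section Cyclic

variable {F : Type*} [Field F]

/-- The parity check matrix whose columns are the coefficients of the remainders of the powers of
the indeterminate. -/
noncomputable def remainderMatrix (r n : ℕ) (g : F[X]) : Matrix (Fin r) (Fin n) F :=
  Matrix.of fun s j => (X ^ (j : ℕ) %ₘ g).coeff s

theorem remainderMatrix_mulVec {r n : ℕ} (g : F[X]) (v : Fin n → F) (s : Fin r) :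
    (remainderMatrix r n g).mulVec v s = ((∑ j, C (v j) * X ^ (j : ℕ)) %ₘ g).coeff s := by
  have h : (∑ j, C (v j) * X ^ (j : ℕ)) %ₘ g = ∑ j, v j • (X ^ (j : ℕ) %ₘ g) := by
    simp only [← smul_eq_C_mul]
    have := map_sum (modByMonicHom g) (fun j => v j • X ^ (j : ℕ)) Finset.univ
    simp only [map_smul] at this
    exact this
  rw [h, finsetSum_coeff]
  simp [remainderMatrix, Matrix.mulVec, dotProduct, mul_comm]

theorem mem_cyclicCode_iff_mulVec {r n : ℕ} {g : F[X]} (hg : g.Monic) (hr : g.natDegree = r)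
    (v : Fin n → F) : v ∈ cyclicCode n g ↔ (remainderMatrix r n g).mulVec v = 0 := by
  change g ∣ _ ↔ _
  rw [← modByMonic_eq_zero_iff_dvd hg]
  constructor
  · intro h
    funext s
    rw [remainderMatrix_mulVec, h, coeff_zero, Pi.zero_apply]
  · intro h
    ext t
    by_cases ht : t < r
    · have := congrFun h ⟨t, ht⟩
      rwa [remainderMatrix_mulVec] at this
    · refine coeff_eq_zero_of_degree_lt ((degree_modByMonic_lt _ hg).trans_le ?_)
      rw [degree_eq_natDegree hg.ne_zero, hr]
      exact_mod_cast not_lt.1 ht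

theorem sum_fin_C_mul_X_pow {n : ℕ} {p : F[X]} (hp : p.degree < n) :
    ∑ j : Fin n, C (p.coeff j) * X ^ (j : ℕ) = p := by
  rw [Fin.sum_univ_eq_sum_range (fun j => C (p.coeff j) * X ^ j) n]
  ext t
  simp only [finsetSum_coeff, coeff_C_mul_X_pow, Finset.sum_ite_eq, Finset.mem_range]
  split_ifs with h
  · rfl
  · exact (coeff_eq_zero_of_degree_lt (hp.trans_le (by exact_mod_cast not_lt.1 h))).symm

/-- The parity checks of two cyclic codes with coprime generators are jointly independent. -/
theorem remainderMatrix_jointly_surjective {r₀ r₁ n : ℕ} {g₀ g₁ : F[X]} (hg₀ : g₀.Monic)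
    (hg₁ : g₁.Monic) (hr₀ : g₀.natDegree = r₀) (hr₁ : g₁.natDegree = r₁) (hc : IsCoprime g₀ g₁)
    (hn : r₀ + r₁ ≤ n) (a : Fin r₀ → F) (b : Fin r₁ → F) :
    ∃ v, (remainderMatrix r₀ n g₀).mulVec v = a ∧ (remainderMatrix r₁ n g₁).mulVec v = b := by
  have hrem : ∀ {r : ℕ} {g : F[X]}, g.Monic → g.natDegree = r → ∀ c : Fin r → F, ∀ p : F[X],
      g ∣ p - ∑ s, C (c s) * X ^ (s : ℕ) → ∀ s : Fin r, (p %ₘ g).coeff s = c s := by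
    intro r g hg hr c p hp s
    have hdeg : (∑ s, C (c s) * X ^ (s : ℕ)).degree < g.degree := by
      rw [degree_eq_natDegree hg.ne_zero, hr]
      exact degree_sum_fin_lt c
    have h : p %ₘ g = ∑ s, C (c s) * X ^ (s : ℕ) := by
      rw [← (modByMonic_eq_self_iff hg).2 hdeg, ← sub_eq_zero, ← sub_modByMonic]
      exact (modByMonic_eq_zero_iff_dvd hg).2 hp
    rw [h, finsetSum_coeff, Finset.sum_eq_single s]
    · simp
    · intro t _ ht
      rw [coeff_C_mul_X_pow, if_neg fun h => ht (Fin.ext h.symm)]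
    · simp
  obtain ⟨x, y, hxy⟩ := hc
  set A := ∑ s, C (a s) * X ^ (s : ℕ) with hA
  set B := ∑ s, C (b s) * X ^ (s : ℕ) with hB
  have hg := hg₀.mul hg₁
  -- Chinese remainder solution, congruent to `A` mod `g₀` and to `B` mod `g₁`; reducing it mod `g₀
  -- * g₁` keeps the degree below `n`.
  set p := (B * (x * g₀) + A * (y * g₁)) %ₘ (g₀ * g₁) with hp
  have hp' := modByMonic_add_div (B * (x * g₀) + A * (y * g₁)) (g₀ * g₁)
  rw [← hp] at hp'
  have hpdeg : p.degree < n := by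
    refine (degree_modByMonic_lt _ hg).trans_le ?_
    rw [degree_eq_natDegree hg.ne_zero, hg₀.natDegree_mul hg₁, hr₀, hr₁]
    exact_mod_cast hn
  refine ⟨fun j => p.coeff j, funext fun s => ?_, funext fun s => ?_⟩ <;>
    rw [remainderMatrix_mulVec, sum_fin_C_mul_X_pow hpdeg]
  · refine hrem hg₀ hr₀ a p ⟨(B - A) * x - g₁ * ((B * (x * g₀) + A * (y * g₁)) /ₘ (g₀ * g₁)), ?_⟩ s
    linear_combination hp' + A * hxy
  · refine hrem hg₁ hr₁ b p ⟨(A - B) * y - g₀ * ((B * (x * g₀) + A * (y * g₁)) /ₘ (g₀ * g₁)), ?_⟩ s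
    linear_combination hp' + B * hxy

theorem isParityCheckMatrix_remainderMatrix {r n : ℕ} {g : F[X]} (hg : g.Monic)
    (hr : g.natDegree = r) (hn : r ≤ n) :
    IsParityCheckMatrix (remainderMatrix r n g) (cyclicCode n g) := by
  refine ⟨?_, mem_cyclicCode_iff_mulVec hg hr⟩
  rw [← Matrix.vecMul_injective_iff]
  refine (injective_iff_map_eq_zero (remainderMatrix r n g).vecMulLinear).2 fun c hc => ?_
  refine dotProduct_eq_zero _ fun w => ?_
  -- With second generator `1` this is surjectivity of a single matrix, hence independence of its
  -- rows.
  obtain ⟨v, rfl, -⟩ := remainderMatrix_jointly_surjective (n := n) hg monic_one hr natDegree_one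
    isCoprime_one_right (by simpa using hn) w Fin.elim0
  rw [Matrix.dotProduct_mulVec]
  exact (congrArg (· ⬝ᵥ v) hc).trans (zero_dotProduct v)

/-- The BCH bound. -/
theorem bch_bound {K : Type*} [Field K] [Algebra F K] {n b δ : ℕ} {α : K} (hα : IsPrimitiveRoot α n)
    (hn : 0 < n) {v : Fin n → F} (hv : v ≠ 0)
    (hzero : ∀ l < δ, aeval (α ^ (b + l)) (∑ j, C (v j) * X ^ (j : ℕ)) = 0) :
    δ + 1 ≤ {j | v j ≠ 0}.ncard := by
  classical
  by_contra! hlt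
  have hα0 : α ≠ 0 := hα.ne_zero hn.ne'
  obtain ⟨j₀, hj₀⟩ := Function.ne_iff.1 hv
  set S := Finset.univ.filter fun j => v j ≠ 0 with hS
  have hcard : S.card ≤ δ := by
    rw [hS, ← Set.ncard_coe_finset]
    simpa using Nat.lt_succ_iff.1 hlt
  have hj₀S : j₀ ∈ S := by simpa [hS] using hj₀
  -- Combining the vanishing sums with the coefficients of `f`, of degree below `δ`, kills every
  -- term of the support except `j₀`.
  set f : K[X] := ∏ j ∈ S.erase j₀, (X - C (α ^ (j : ℕ))) with hf
  have hfdeg : f.natDegree < δ := by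
    rw [hf, natDegree_prod_of_monic _ _ fun j _ => monic_X_sub_C _]
    simp only [natDegree_X_sub_C, Finset.sum_const, smul_eq_mul, mul_one]
    exact (Finset.card_erase_lt_of_mem hj₀S).trans_le hcard
  have hz : ∀ l < δ, ∑ j, algebraMap F K (v j) * (α ^ (j : ℕ)) ^ b * (α ^ (j : ℕ)) ^ l = 0 := by
    intro l hl
    rw [← hzero l hl, map_sum]
    refine Finset.sum_congr rfl fun j _ => ?_
    rw [map_mul, aeval_C, map_pow, aeval_X, mul_assoc, ← pow_add, ← pow_mul, ← pow_mul,
      mul_comm (j : ℕ)]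
  have hsum : ∑ j, algebraMap F K (v j) * (α ^ (j : ℕ)) ^ b * f.eval (α ^ (j : ℕ)) = 0 := by
    simp only [eval_eq_sum_range' hfdeg, Finset.mul_sum]
    rw [Finset.sum_comm]
    refine Finset.sum_eq_zero fun l hl => ?_
    calc _ = f.coeff l * ∑ j, algebraMap F K (v j) * (α ^ (j : ℕ)) ^ b * (α ^ (j : ℕ)) ^ l := by
          rw [Finset.mul_sum]
          exact Finset.sum_congr rfl fun j _ => by ring
      _ = 0 := by rw [hz l (Finset.mem_range.1 hl), mul_zero]
  rw [Finset.sum_eq_single j₀] at hsum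
  · have hfe : f.eval (α ^ (j₀ : ℕ)) ≠ 0 := by
      rw [hf, eval_prod, Finset.prod_ne_zero_iff]
      intro j hj
      rw [eval_sub, eval_X, eval_C, sub_ne_zero]
      intro h
      exact (Finset.ne_of_mem_erase hj) (Fin.ext (hα.pow_inj j₀.2 j.2 h)).symm
    refine mul_ne_zero (mul_ne_zero ?_ (pow_ne_zero _ (pow_ne_zero _ hα0))) hfe hsum
    simpa using hj₀
  · intro j _ hj
    by_cases hjv : v j = 0
    · simp [hjv]
    · have : f.eval (α ^ (j : ℕ)) = 0 := by
        rw [hf, eval_prod]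
        exact Finset.prod_eq_zero (Finset.mem_erase.2 ⟨hj, by simpa [hS] using hjv⟩) (by simp)
      rw [this, mul_zero]
  · simp

end Cyclic

section Minpoly

variable {F K : Type*} [Field F] [Field K] [Algebra F K] [FiniteDimensional F K]

theorem minpoly_monic (x : K) : (minpoly F x).Monic := minpoly.monic (IsIntegral.of_finite F x)

theorem isCoprime_minpoly {x y : K} (h : minpoly F x ≠ minpoly F y) :
    IsCoprime (minpoly F x) (minpoly F y) := by
  have hx := minpoly.irreducible (IsIntegral.of_finite F x)
  have hy := minpoly.irreducible (IsIntegral.of_finite F y)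
  refine (hx.coprime_iff_not_dvd).2 fun hd => h ?_
  exact eq_of_monic_of_associated (minpoly_monic x) (minpoly_monic y)
    (hx.associated_of_dvd hy hd)

end Minpoly

/-! ### Minimal polynomials in a quadratic extension of a finite field -/

section Quadratic

variable {F K : Type*} [Field F] [Fintype F] [Field K] [Algebra F K]

theorem aeval_pow_card (p : F[X]) (x : K) :
    aeval (x ^ Fintype.card F) p = aeval x p ^ Fintype.card F := by
  rw [← expand_aeval, FiniteField.expand_card, map_pow]

/-- The elements of `F` already exhaust the at most `q` roots of `X^q - X` in `K`. -/
theorem mem_range_algebraMap_of_pow_card {x : K} (hx : x ^ Fintype.card F = x) :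
    x ∈ (algebraMap F K).range := by
  classical
  have hq := Fintype.one_lt_card (α := F)
  have h0 := FiniteField.X_pow_card_sub_X_ne_zero K hq
  by_contra hx'
  have hsub : insert x (Finset.univ.image (algebraMap F K)) ⊆
      (X ^ Fintype.card F - X : K[X]).roots.toFinset := by
    intro y hy
    rw [Multiset.mem_toFinset, mem_roots h0, IsRoot.def, eval_sub, eval_pow, eval_X, sub_eq_zero]
    rcases Finset.mem_insert.1 hy with rfl | hy
    · exact hx
    · obtain ⟨a, -, rfl⟩ := Finset.mem_image.1 hy
      rw [← map_pow, FiniteField.pow_card]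
  have h := ((Finset.card_le_card hsub).trans (Multiset.toFinset_card_le _)).trans (card_roots' _)
  rw [FiniteField.X_pow_card_sub_X_natDegree_eq K hq, Finset.card_insert_of_notMem (by
    simpa using hx'), Finset.card_image_of_injective _ (algebraMap F K).injective,
    Finset.card_univ] at h
  omega

theorem natDegree_minpoly_of_pow_card_eq {x : K} (hx : x ^ Fintype.card F = x) :
    (minpoly F x).natDegree = 1 :=
  minpoly.natDegree_eq_one_iff.2 (mem_range_algebraMap_of_pow_card hx)

variable [FiniteDimensional F K]

theorem natDegree_minpoly_of_pow_card_ne (hK : Module.finrank F K = 2) {x : K}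
    (hx : x ^ Fintype.card F ≠ x) : (minpoly F x).natDegree = 2 := by
  have h1 : (minpoly F x).natDegree ≠ 1 := fun h => by
    obtain ⟨a, rfl⟩ := minpoly.natDegree_eq_one_iff.1 h
    exact hx (by rw [← map_pow, FiniteField.pow_card])
  have h2 := minpoly.natDegree_pos (IsIntegral.of_finite F x)
  have h3 := hK ▸ minpoly.natDegree_le (A := F) x
  omega

/-- A further `y` would give the common minimal polynomial more roots than its degree, which is 1 or
2 according to whether `x^q = x`. -/
theorem eq_or_eq_pow_card_of_minpoly_eq (hK : Module.finrank F K = 2) {x y : K}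
    (h : minpoly F x = minpoly F y) : y = x ∨ y = x ^ Fintype.card F := by
  classical
  by_contra! hne
  have hroot : ∀ z, aeval z (minpoly F x) = 0 → z ∈ (minpoly F x).rootSet K := fun z hz =>
    mem_rootSet.2 ⟨minpoly.ne_zero (IsIntegral.of_finite F x), hz⟩
  have hx := hroot x (minpoly.aeval F x)
  have hy := hroot y (h ▸ minpoly.aeval F y)
  have hxq : x ^ Fintype.card F ∈ (minpoly F x).rootSet K := hroot _ (by
    rw [aeval_pow_card, minpoly.aeval, zero_pow Fintype.card_ne_zero])
  have hcard : ∀ s : Finset K, (s : Set K) ⊆ (minpoly F x).rootSet K →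
      s.card ≤ (minpoly F x).natDegree := fun s hs => by
    rw [rootSet_def, Finset.coe_subset] at hs
    exact ((Finset.card_le_card hs).trans (Multiset.toFinset_card_le _)).trans
      ((card_roots' _).trans natDegree_map_le)
  by_cases hxx : x ^ Fintype.card F = x
  · have := hcard {y, x} (by simp [Set.insert_subset_iff, hx, hy])
    rw [natDegree_minpoly_of_pow_card_eq hxx, Finset.card_pair hne.1] at this
    omega
  · have := hcard {y, x, x ^ Fintype.card F} (by simp [Set.insert_subset_iff, hx, hy, hxq])
    rw [natDegree_minpoly_of_pow_card_ne hK hxx, Finset.card_eq_three.2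
      ⟨_, _, _, hne.1, hne.2, Ne.symm hxx, rfl⟩] at this
    omega

end Quadratic

/-! ### Zeros and degrees of the two generator polynomials -/

section Zeros

variable {F K : Type*} [Field F] [Field K] [Algebra F K] {α : K}

theorem aeval_eq_zero_of_mem_cyclicCode {n : ℕ} {S : Finset ℕ} {v : Fin n → F}
    (hv : v ∈ cyclicCode n (∏ s ∈ S, minpoly F (α ^ s))) {s : ℕ} (hs : s ∈ S) :
    aeval (α ^ s) (∑ j, C (v j) * X ^ (j : ℕ)) = 0 := by
  obtain ⟨p, hp⟩ := (Finset.dvd_prod_of_mem (fun s => minpoly F (α ^ s)) hs).trans hv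
  rw [hp, map_mul, minpoly.aeval, zero_mul]

end Zeros

/-- Equality would mean that `q² - 1 = (q + 1)(q - 1)` divides `s (q - 1)`. -/
theorem pow_pow_card_ne {F K : Type*} [Field F] [Fintype F] [Field K] {α : K}
    (hα : IsPrimitiveRoot α (Fintype.card F ^ 2 - 1)) {s : ℕ}
    (hs : ¬ (Fintype.card F + 1) ∣ s) : (α ^ s) ^ Fintype.card F ≠ α ^ s := by
  intro h
  have hq : 1 < Fintype.card F := Fintype.one_lt_card
  obtain ⟨m, hm⟩ : ∃ m, Fintype.card F = m + 1 := ⟨Fintype.card F - 1, by omega⟩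
  have hα0 : α ≠ 0 := hα.ne_zero (by rw [hm] at hq ⊢; ring_nf; omega)
  rw [hm, pow_succ, mul_eq_right₀ (pow_ne_zero _ hα0), ← pow_mul, hα.pow_eq_one_iff_dvd,
    show Fintype.card F ^ 2 - 1 = (Fintype.card F + 1) * m by rw [hm]; ring_nf; omega] at h
  exact hs (Nat.dvd_of_mul_dvd_mul_right (by omega) h)

section PrimitiveElement

variable {F K : Type*} [Field F] [Fintype F] [Field K] [Algebra F K] {α : K}

variable [FiniteDimensional F K]

theorem natDegree_prod_minpoly_pow (hK : Module.finrank F K = 2)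
    (hα : IsPrimitiveRoot α (Fintype.card F ^ 2 - 1)) {a b : ℕ} (hab : a ≤ b)
    (ha : (α ^ a) ^ Fintype.card F = α ^ a)
    (hb : ∀ s, a < s → s ≤ b → ¬ (Fintype.card F + 1) ∣ s) :
    (∏ s ∈ Finset.Icc a b, minpoly F (α ^ s)).natDegree = 2 * (b - a) + 1 := by
  rw [natDegree_prod_of_monic _ _ fun s _ => minpoly_monic _, Finset.Icc_eq_cons_Ioc hab,
    Finset.sum_cons, natDegree_minpoly_of_pow_card_eq ha, Finset.sum_congr rfl fun s hs =>
      natDegree_minpoly_of_pow_card_ne hK (pow_pow_card_ne hα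
        (hb s (Finset.mem_Ioc.1 hs).1 (Finset.mem_Ioc.1 hs).2))]
  simp
  ring

theorem isCoprime_prod_minpoly_pow (hK : Module.finrank F K = 2)
    (hα : IsPrimitiveRoot α (Fintype.card F ^ 2 - 1)) {i : ℕ} (hq : 2 ≤ Fintype.card F)
    (hi : i + 3 ≤ Fintype.card F) :
    IsCoprime (∏ s ∈ Finset.Icc 0 (Fintype.card F - 1), minpoly F (α ^ s))
      (∏ s ∈ Finset.Icc (Fintype.card F + 1) (Fintype.card F + 1 + i), minpoly F (α ^ s)) := by
  refine IsCoprime.prod_left fun s hs => IsCoprime.prod_right fun t ht => isCoprime_minpoly ?_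
  rw [Finset.mem_Icc] at hs ht
  have hs' : s + 1 ≤ Fintype.card F := by omega
  have h1 : s * Fintype.card F + Fintype.card F ≤ Fintype.card F ^ 2 := by nlinarith
  have h2 : 2 * Fintype.card F ≤ Fintype.card F ^ 2 := by nlinarith
  intro h
  -- All exponents are below `q² - 1`, so `t = s` or `t = s q`. The multiples `0`, `q`, `2q`, … of
  -- `q` miss the interval from `q + 1` to `q + 1 + i ≤ 2q - 2`.
  rcases eq_or_eq_pow_card_of_minpoly_eq hK h with h | h
  · have := hα.pow_inj (by omega) (by omega) h
    omega
  · rw [← pow_mul] at h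
    have := hα.pow_inj (by omega) (by omega) h
    rcases s with _ | _ | s
    · omega
    · omega
    · have : 2 * Fintype.card F ≤ (s + 1 + 1) * Fintype.card F := Nat.mul_le_mul_right _ (by omega)
      omega

end PrimitiveElement

end ConvCode

theorem mainTheorem8 {F K : Type*} [Field F] [Fintype F] [Field K] [Algebra F K]
    (q i : ℕ) (hF : Fintype.card F = q) (hq : 4 ≤ q)
    (hK : Module.finrank F K = 2) (α : K) (hα : IsPrimitiveRoot α (q ^ 2 - 1))
    (hi : 1 ≤ i) (hi' : i ≤ q - 3) :
    ∃ V : Submodule (Polynomial F) (Fin (q ^ 2 - 1) → Polynomial F),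
      ConvCode.HasParameters V (q ^ 2 - 1 - 2 * q + 1) (2 * i + 1) 1 (q + i + 3) ∧
      ∃ (H₀ : Matrix (Fin (2 * q - 1)) (Fin (q ^ 2 - 1)) F)
        (H₁ : Matrix (Fin (2 * i + 1)) (Fin (q ^ 2 - 1)) F),
        ConvCode.IsParityCheckMatrix H₀
          (ConvCode.cyclicCode (q ^ 2 - 1) (∏ s ∈ Finset.Icc 0 (q - 1), minpoly F (α ^ s))) ∧
        ConvCode.IsParityCheckMatrix H₁
          (ConvCode.cyclicCode (q ^ 2 - 1)
            (∏ s ∈ Finset.Icc (q + 1) (q + 1 + i), minpoly F (α ^ s))) ∧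
        V = ConvCode.euclideanDual
          (ConvCode.generatedCode (ConvCode.unitMemoryMatrix H₀ H₁)) := by
  have : FiniteDimensional F K := Module.finite_of_finrank_pos (by omega)
  have hsq : 4 * q ≤ q ^ 2 := by nlinarith
  have hq2 : (q + 1) * q = (q ^ 2 - 1) + (q + 1) := by
    rw [show (q + 1) * q = q ^ 2 + q by ring]
    omega
  subst hF
  set q := Fintype.card F with hqdef
  set n := q ^ 2 - 1 with hn
  have hn0 : 0 < n := by omega
  set g₀ := ∏ s ∈ Finset.Icc 0 (q - 1), minpoly F (α ^ s) with hg₀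
  set g₁ := ∏ s ∈ Finset.Icc (q + 1) (q + 1 + i), minpoly F (α ^ s) with hg₁
  have hm₀ : g₀.Monic := monic_prod_of_monic _ _ fun s _ => ConvCode.minpoly_monic _
  have hm₁ : g₁.Monic := monic_prod_of_monic _ _ fun s _ => ConvCode.minpoly_monic _
  have hd₀ : g₀.natDegree = 2 * q - 1 := by
    rw [hg₀, ConvCode.natDegree_prod_minpoly_pow hK hα (Nat.zero_le _) (by simp)]
    · omega
    · intro s h1 h2 h3
      have := Nat.le_of_dvd h1 h3
      omega
  have hd₁ : g₁.natDegree = 2 * i + 1 := by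
    rw [hg₁, ConvCode.natDegree_prod_minpoly_pow hK hα (by omega)]
    · omega
    -- `α^(q+1)` lies in `F`, so it contributes degree 1.
    · rw [← pow_mul, hq2, pow_add, hα.pow_eq_one, one_mul]
    · intro s h1 h2 h3
      have h4 := (Nat.dvd_sub h3 (dvd_refl (q + 1)))
      have := Nat.le_of_dvd (by omega) h4
      omega
  have hcop : IsCoprime g₀ g₁ := ConvCode.isCoprime_prod_minpoly_pow hK hα (by omega) (by omega)
  set H₀ := ConvCode.remainderMatrix (2 * q - 1) n g₀
  set H₁ := ConvCode.remainderMatrix (2 * i + 1) n g₁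
  have hP₀ : ConvCode.IsParityCheckMatrix H₀ (ConvCode.cyclicCode n g₀) :=
    ConvCode.isParityCheckMatrix_remainderMatrix hm₀ hd₀ (by omega)
  have hP₁ : ConvCode.IsParityCheckMatrix H₁ (ConvCode.cyclicCode n g₁) :=
    ConvCode.isParityCheckMatrix_remainderMatrix hm₁ hd₁ (by omega)
  have hz₀ : ∀ v, H₀.mulVec v = 0 → ∀ l ≤ q,
      aeval (α ^ l) (∑ j, C (v j) * X ^ (j : ℕ)) = 0 := by
    intro v hv l hl
    have hv' := (hP₀.2 v).2 hv
    rcases hl.lt_or_eq with hl | rfl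
    · exact ConvCode.aeval_eq_zero_of_mem_cyclicCode hv' (by rw [Finset.mem_Icc]; omega)
    -- The zero `α^q`, conjugate to `α`, fills the gap between the two runs of exponents.
    · have h1 := ConvCode.aeval_eq_zero_of_mem_cyclicCode hv' (s := 1)
        (by rw [Finset.mem_Icc]; omega)
      rw [pow_one] at h1
      rw [ConvCode.aeval_pow_card, h1, zero_pow Fintype.card_ne_zero]
  have hz₁ : ∀ v, H₁.mulVec v = 0 → ∀ l, q + 1 ≤ l → l ≤ q + 1 + i →
      aeval (α ^ l) (∑ j, C (v j) * X ^ (j : ℕ)) = 0 := fun v hv l h1 h2 =>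
    ConvCode.aeval_eq_zero_of_mem_cyclicCode ((hP₁.2 v).2 hv) (Finset.mem_Icc.2 ⟨h1, h2⟩)
  refine ⟨_, ?_, H₀, H₁, hP₀, hP₁, rfl⟩
  refine ConvCode.hasParameters_euclideanDual (by omega) (by omega) (by omega) (by omega) H₀ H₁
    (ConvCode.remainderMatrix_jointly_surjective hm₀ hm₁ hd₀ hd₁ hcop (by omega)) fun u hu hu0 =>
    ConvCode.le_weight_of_mem_euclideanDual (d₀ := q + 2) (d₁ := i + 2) (by omega)
      (fun v hv h0 => ?_) (fun v hv h1 => ?_) (fun v hv h0 h1 => ?_) (by omega) hu hu0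
  · exact ConvCode.bch_bound (b := 0) (δ := q + 1) hα hn0 hv fun l hl => hz₀ v h0 _ (by omega)
  · exact ConvCode.bch_bound (b := q + 1) (δ := i + 1) hα hn0 hv fun l hl =>
      hz₁ v h1 _ (by omega) (by omega)
  · refine ConvCode.bch_bound (b := 0) (δ := q + i + 2) hα hn0 hv fun l hl => ?_
    by_cases h : l ≤ q
    · exact hz₀ v h0 _ (by omega)
    · exact hz₁ v h1 _ (by omega) (by omega)
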